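/- Let $\kappa$ be an uncountable regular cardinal. Then there is a family of cardinality $2^\kappa$ of compact Hausdorff spaces $K$ of weight $\kappa$ such that the corresponding Banach spaces $C(K)$ of real-valued continuous functions (with the supremum norm) are pairwise nonisomorphic. More precisely, let $E^\kappa_\omega=\{\alpha<\kappa:\operatorname{cf}(\alpha)=\omega\}$. A ladder system on $\kappa$ is a family $\mathcal L=\{L_\alpha:\alpha\in E^\kappa_\omega\}$ such that, for every $\alpha\in E^\kappa_\omega$, $L_\alpha\subseteq\{\beta+1:\beta<\alpha\}$, $L_\alpha\cap\beta$ is finite for all $\beta<\alpha$, and $\sup L_\alpha=\alpha$. For $S\subseteq E^\kappa_\omega$ the ladder system space $X_S=X_S(\mathcal L)$ has the set of points $\kappa$; the points of $\kappa\setminus S$ are isolated, and the basic neighbourhoods of $\alpha\in S$ are the sets $(L_\alpha\setminus F)\cup\{\alpha\}$ with $F\subseteq L_\alpha$ finite. Let $KL_S$ be the one-point compactification of $X_S$, and $C_0(X_S)$ the Banach space of real-valued continuous functions on $X_S$ vanishing at infinity. Then: 1. Ladder systems on $\kappa$ exist, and there is a family $(S_\xi)_{\xi<\kappa}$ of pairwise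 disjoint subsets of $E^\kappa_\omega$ that are stationary in $\kappa$. 2. For every ladder system $\mathcal L$ and every such family $(S_\xi)_{\xi<\kappa}$, put $S(A)=\bigcup_{\xi\in A}S_\xi$ for $A\subseteq\kappa$. Then each $KL_{S(A)}$ is a compact Hausdorff space of weight $\kappa$, and the Banach spaces $C(KL_{S(A)})$ and $C(KL_{S(B)})$ are not isomorphic whenever $A\ne B$ are subsets of $\kappa$. 3. For every ladder system $\mathcal L$ and all $R,S\subseteq E^\kappa_\omega$ such that $S\setminus R$ is stationary in $\kappa$, there is no bounded linear operator $C_0(X_R)\to C_0(X_S)$ with dense range, and no bounded linear operator $C(KL_R)\to C(KL_S)$ with dense range. -/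

import Mathlib

universe u

open Cardinal Set
open scoped Cardinal ZeroAtInfty

/-- The weight of a topological space: the least cardinality of a base of its topology. -/
noncomputable def topologicalWeight (X : Type u) [TopologicalSpace X] : Cardinal.{u} :=
  ⨅ B : {B : Set (Set X) // TopologicalSpace.IsTopologicalBasis B}, #B.1

/-- The set `E^κ_ω` of the ordinals below `κ` whose cofinality is `ω`. The type `κ.ord.ToType` is
Mathlib's copy, in the universe of `κ`, of the well-ordered set of the ordinals below `κ`. -/
def cofOmega (κ : Cardinal.{u}) : Set κ.ord.ToType :=
  {α | (α : Ordinal.{u}).cof = ℵ₀}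

/-- A ladder system on `κ`: for every `α < κ` of cofinality `ω` a set `L_α` of successor ordinals
`β + 1` with `β < α`, such that `L_α ∩ β` is finite for all `β < α`, and `sup L_α = α`.
(The values of `ladder` outside of `E^κ_ω` are irrelevant and never used for `S ⊆ E^κ_ω`.) -/
structure LadderSystem (κ : Cardinal.{u}) where
  ladder : κ.ord.ToType → Set κ.ord.ToType
  subset_succ : ∀ α ∈ cofOmega κ, ladder α ⊆ {γ | ∃ β < α, γ = Order.succ β}
  finite_inter : ∀ α ∈ cofOmega κ, ∀ β < α, (ladder α ∩ Iio β).Finite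
  isLUB : ∀ α ∈ cofOmega κ, IsLUB (ladder α) α

namespace LadderSystem

variable {κ : Cardinal.{u}}

/-- The underlying set of the ladder system space `X_S`: the ordinals below `κ`. -/
def Space (_L : LadderSystem κ) (_S : Set κ.ord.ToType) : Type u := κ.ord.ToType

/-- The topology of `X_S`: points outside of `S` are isolated, and the basic neighbourhoods of
`α ∈ S` are the sets `(L_α \ F) ∪ {α}` with `F ⊆ L_α` finite. -/
instance (L : LadderSystem κ) (S : Set κ.ord.ToType) : TopologicalSpace (L.Space S) where
  IsOpen U := ∀ α : κ.ord.ToType, α ∈ S → α ∈ (U : Set κ.ord.ToType) →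
    ∃ F : Set κ.ord.ToType, F.Finite ∧ F ⊆ L.ladder α ∧
      (L.ladder α \ F) ∪ {α} ⊆ (U : Set κ.ord.ToType)
  isOpen_univ := fun α _ _ => ⟨∅, finite_empty, empty_subset _, subset_univ _⟩
  isOpen_inter := by
    rintro U V hU hV α hα ⟨hαU, hαV⟩
    obtain ⟨F, hF, hFL, hFU⟩ := hU α hα hαU
    obtain ⟨G, hG, hGL, hGV⟩ := hV α hα hαV
    refine ⟨F ∪ G, hF.union hG, union_subset hFL hGL, subset_inter ?_ ?_⟩
    · exact (union_subset_union_left _ (sdiff_subset_sdiff_right subset_union_left)).trans hFU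
    · exact (union_subset_union_left _ (sdiff_subset_sdiff_right subset_union_right)).trans hGV
  isOpen_sUnion := by
    rintro 𝒰 h𝒰 α hα ⟨U, hU, hαU⟩
    obtain ⟨F, hF, hFL, hFU⟩ := h𝒰 U hU α hα hαU
    exact ⟨F, hF, hFL, hFU.trans (subset_sUnion_of_mem hU)⟩

/-- The one-point compactification `KL_S` of the ladder system space `X_S`. -/
abbrev KL (L : LadderSystem κ) (S : Set κ.ord.ToType) : Type u := OnePoint (L.Space S)

end LadderSystem

/-- A family `(S_ξ)_{ξ < κ}` of pairwise disjoint subsets of `E^κ_ω`, each stationary in `κ`. -/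
structure IsDisjointStationaryFamily {κ : Cardinal.{u}}
    (St : κ.ord.ToType → Set κ.ord.ToType) : Prop where
  subset_cofOmega : ∀ ξ, St ξ ⊆ cofOmega κ
  isStationary : ∀ ξ, IsStationary (St ξ)
  disjoint : ∀ ξ η, ξ ≠ η → Disjoint (St ξ) (St η)

/-! The Banach space remembers S up to a nonstationary set. Let T : C₀(X_R) → C₀(X_S) be bounded
with S \ R stationary. Countable subsets of κ are bounded, so each function in C₀(X_S) vanishes
above some ordinal (`exists_support_bound`), and each functional on C₀(X_R) kills the functions
supported above some ordinal (`exists_functional_bound`). Closing off under these bounds gives a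
club of δ such that T sends the characteristic functions of the basic neighbourhoods of all γ < δ to
functions vanishing at δ, and sends functions vanishing below δ to functions vanishing below δ.

Take such a δ in S \ R. Since δ ∉ R, the initial segment below δ is clopen in X_R, and every f
splits there. The lower part is approximated by combinations of those characteristic functions
(`functional_eq_zero_of_basicFun`), so its image vanishes at δ. The image of the upper part vanishes
along the ladder at δ ∈ S, hence at δ by continuity (`apply_eq_zero_of_forall_lt`). So the whole
range of T vanishes at δ and is not dense. Passing from C₀ to C(KL) adds only the constants, whose
image costs one more support bound.

If A ≠ B, then S(A) \ S(B) or S(B) \ S(A) contains some S_ξ. The S_ξ come from Fodor's lemma applied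
to one coordinate of chosen cofinal ω-sequences. -/

section WellOrder

/-! ### Club and stationary sets in well-orders -/

variable {W : Type u} [LinearOrder W]

theorem exists_isLUB_of_bddAbove [WellFoundedLT W] {s : Set W} (hs : BddAbove s) : ∃ a, IsLUB s a := by
  obtain ⟨a, ha, hmin⟩ := WellFounded.has_min (wellFounded_lt (α := W)) (upperBounds s) hs
  exact ⟨a, ha, fun b hb => not_lt.1 (hmin b hb)⟩

theorem bddAbove_of_card_lt_cof {s : Set W} (hs : #s < Order.cof W) : BddAbove s :=
  .of_not_isCofinal fun h => (Order.cof_le h).not_gt hs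

theorem bddAbove_range_nat [WellFoundedLT W] (hW : ℵ₀ < Order.cof W) (f : ℕ → W) : BddAbove (range f) :=
  bddAbove_of_card_lt_cof <| by
    refine lt_of_le_of_lt ?_ hW
    simpa using mk_range_le_lift (f := f)

theorem IsClub.Ioi [NoMaxOrder W] (a : W) : IsClub (Ioi a) where
  dirSupClosed := by
    intro d hd hne _ x hx
    obtain ⟨y, hy⟩ := hne
    exact (mem_Ioi.1 (hd hy)).trans_le (hx.1 hy)
  isCofinal x := by
    obtain ⟨y, hy⟩ := exists_gt (max a x)
    exact ⟨y, (le_max_left _ _).trans_lt hy, (le_max_right _ _).trans hy.le⟩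

/-- The diagonal intersection of a family of club sets is a club set. -/
theorem IsClub.diagonal_inter [WellFoundedLT W] [NoMaxOrder W] (hW : ℵ₀ < Order.cof W)
    (hI : ∀ a : W, #(Iic a) < Order.cof W) {C : W → Set W} (hC : ∀ a, IsClub (C a)) :
    IsClub {δ | ∀ γ < δ, δ ∈ C γ} where
  dirSupClosed := by
    intro d hd hne _ x hx γ hγ
    obtain ⟨y, hy, hγy⟩ := (lt_isLUB_iff hx).1 hγ
    -- Only the members of `d` above `γ` are known to lie in `C γ`; discarding the rest keeps the
    -- supremum.
    refine (hC γ).isLUB_mem (t := d ∩ Set.Ioi γ) (fun z hz => hd hz.1 γ hz.2) ⟨y, hy, hγy⟩ ⟨?_, ?_⟩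
    · exact fun z hz => hx.1 hz.1
    · intro b hb
      refine hx.2 fun z hz => ?_
      rcases lt_or_ge γ z with h | h
      · exact hb ⟨hz, h⟩
      · exact h.trans (hγy.le.trans (hb ⟨hy, hγy⟩))
  isCofinal a := by
    have key : ∀ x : W, ∃ y, x < y ∧ ∀ γ ≤ x, y ∈ C γ := by
      intro x
      have h1 : IsClub (⋂ γ : Iic x, C γ) := IsClub.iInter hW.ne' (by simpa using hI x) fun γ => hC γ
      obtain ⟨z, hz⟩ := exists_gt x
      obtain ⟨y, hy, hzy⟩ := h1.isCofinal z
      exact ⟨y, hz.trans_le hzy, fun γ hγ => mem_iInter.1 hy ⟨γ, hγ⟩⟩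
    choose g hg hgC using key
    let f : ℕ → W := fun n => g^[n] a
    have hf : ∀ n, f (n + 1) = g (f n) := fun n => Function.iterate_succ_apply' g n a
    have hmono : StrictMono f := strictMono_nat_of_lt_succ fun n => by rw [hf]; exact hg _
    obtain ⟨δ, hδ⟩ := exists_isLUB_of_bddAbove (bddAbove_range_nat hW f)
    refine ⟨δ, fun γ hγ => ?_, hδ.1 ⟨0, rfl⟩⟩
    obtain ⟨_, ⟨n, rfl⟩, hn⟩ := (lt_isLUB_iff hδ).1 hγ
    -- Once `γ < f n`, every later term is a value of `g` at a point above `γ`, hence lies in `C γ`.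
    refine (hC γ).isLUB_mem (t := range fun m => f (n + m + 1)) ?_ (range_nonempty _) ⟨?_, ?_⟩
    · rintro _ ⟨m, rfl⟩
      simp only [hf]
      exact hgC _ _ (hn.le.trans (hmono.monotone (Nat.le_add_right n m)))
    · rintro _ ⟨m, rfl⟩
      exact hδ.1 ⟨_, rfl⟩
    · intro b hb
      refine hδ.2 ?_
      rintro _ ⟨m, rfl⟩
      exact (hmono.monotone (by omega : m ≤ n + m + 1)).trans (hb ⟨m, rfl⟩)

/-- **Fodor's lemma**: a regressive function on a stationary set has a stationary fibre. -/
theorem IsStationary.exists_stationary_fiber [WellFoundedLT W] [NoMaxOrder W] (hW : ℵ₀ < Order.cof W)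
    (hI : ∀ a : W, #(Iic a) < Order.cof W) {S : Set W} (hS : IsStationary S) {f : W → W}
    (hf : ∀ α ∈ S, f α < α) : ∃ γ, IsStationary {α ∈ S | f α = γ} := by
  by_contra! h
  simp_rw [not_isStationary_iff] at h
  choose C hC hdisj using h
  -- As `f δ < δ`, the diagonal intersection puts `δ` into `C (f δ)`, which avoids the fibre
  -- containing `δ`.
  obtain ⟨δ, hδS, hδ⟩ := hS (IsClub.diagonal_inter hW hI hC)
  exact disjoint_left.1 (hdisj (f δ)) ⟨hδS, rfl⟩ (hδ _ (hf δ hδS))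

/-- The limits of sequences of smaller elements. -/
def IsOmegaLimit (δ : W) : Prop :=
  ∃ f : ℕ → W, (∀ n, f n < δ) ∧ ∀ β < δ, ∃ n, β < f n

theorem isOmegaLimit_of_cof_Iio [WellFoundedLT W] {δ : W} (h : Order.cof (Iio δ) = ℵ₀) : IsOmegaLimit δ := by
  obtain ⟨s, hs, hcard⟩ := Order.exists_cof_eq (Iio δ)
  rw [h] at hcard
  have hne : Nonempty (Iio δ) := Order.cof_ne_zero_iff.1 (by rw [h]; exact aleph0_ne_zero)
  have hnt : NoTopOrder (Iio δ) := Order.one_lt_cof_iff.1 (by rw [h]; exact one_lt_aleph0)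
  have hnm : NoMaxOrder (Iio δ) := (noTopOrder_iff_noMaxOrder _).1 hnt
  have : Countable s := mk_le_aleph0_iff.1 hcard.le
  have : Nonempty s := hs.nonempty.to_subtype
  obtain ⟨e, he⟩ := exists_surjective_nat s
  refine ⟨fun n => (e n).1.1, fun n => (e n).1.2, fun β hβ => ?_⟩
  obtain ⟨γ, hγ⟩ := exists_gt (⟨β, hβ⟩ : Iio δ)
  obtain ⟨z, hz, hγz⟩ := hs γ
  obtain ⟨n, hn⟩ := he ⟨z, hz⟩
  refine ⟨n, ?_⟩
  simp only [hn]
  exact Subtype.coe_lt_coe.2 (hγ.trans_le hγz)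

theorem IsOmegaLimit.cof_Iio {δ : W} (h : IsOmegaLimit δ) : Order.cof (Iio δ) = ℵ₀ := by
  obtain ⟨f, hf, hcof⟩ := h
  have : Nonempty (Iio δ) := ⟨⟨f 0, hf 0⟩⟩
  have : NoMaxOrder (Iio δ) := ⟨fun a => by
    obtain ⟨n, hn⟩ := hcof a.1 a.2
    exact ⟨⟨f n, hf n⟩, hn⟩⟩
  refine le_antisymm ?_ Order.aleph0_le_cof
  refine (Order.cof_le (s := range fun n => (⟨f n, hf n⟩ : Iio δ)) ?_).trans ?_
  · intro a
    obtain ⟨n, hn⟩ := hcof a.1 a.2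
    exact ⟨_, ⟨n, rfl⟩, hn.le⟩
  · simpa using mk_range_le_lift (f := fun n => (⟨f n, hf n⟩ : Iio δ))

theorem IsOmegaLimit.exists_between {δ β : W} (h : IsOmegaLimit δ) (hβ : β < δ) :
    ∃ γ, β < γ ∧ γ < δ := by
  obtain ⟨f, hf, hcof⟩ := h
  obtain ⟨n, hn⟩ := hcof β hβ
  exact ⟨f n, hn, hf n⟩

theorem isStationary_isOmegaLimit [WellFoundedLT W] [NoMaxOrder W] [Nonempty W] (hW : ℵ₀ < Order.cof W) :
    IsStationary {δ : W | IsOmegaLimit δ} := by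
  intro C hC
  have key : ∀ x : W, ∃ y ∈ C, x < y := fun x => by
    obtain ⟨z, hz⟩ := exists_gt x
    obtain ⟨y, hy, hzy⟩ := hC.isCofinal z
    exact ⟨y, hy, hz.trans_le hzy⟩
  choose g hgC hg using key
  let a : W := Classical.arbitrary W
  -- The shift drops `a` itself, which need not belong to `C`.
  let f : ℕ → W := fun n => g^[n + 1] a
  have hf : ∀ n, f n = g (g^[n] a) := fun n => Function.iterate_succ_apply' g n a
  have hmono : StrictMono f := strictMono_nat_of_lt_succ fun n => by rw [hf (n + 1)]; exact hg _
  obtain ⟨δ, hδ⟩ := exists_isLUB_of_bddAbove (bddAbove_range_nat hW f)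
  refine ⟨δ, ⟨f, fun n => (hmono n.lt_succ_self).trans_le (hδ.1 ⟨_, rfl⟩), fun β hβ => ?_⟩,
    hC.isLUB_mem ?_ (range_nonempty f) hδ⟩
  · obtain ⟨_, ⟨n, rfl⟩, hn⟩ := (lt_isLUB_iff hδ).1 hβ
    exact ⟨n, hn⟩
  · rintro _ ⟨n, rfl⟩
    rw [hf]
    exact hgC _

/-- A stationary set of points of cofinality `ω` contains `κ` many disjoint stationary sets. -/
theorem IsStationary.exists_disjoint_family [WellFoundedLT W] [NoMaxOrder W] (hW : ℵ₀ < Order.cof W)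
    (hreg : Order.cof W = #W)
    (hI : ∀ a : W, #(Iic a) < Order.cof W) {E : Set W} (hE : IsStationary E)
    (hlim : ∀ α ∈ E, IsOmegaLimit α) :
    ∃ St : W → Set W, (∀ ξ, St ξ ⊆ E) ∧ (∀ ξ, IsStationary (St ξ)) ∧
      ∀ ξ η, ξ ≠ η → Disjoint (St ξ) (St η) := by
  have : Nonempty W := hE.nonempty.to_type
  have hchoice : ∀ α, ∃ f : ℕ → W, α ∈ E → (∀ n, f n < α) ∧ ∀ β < α, ∃ n, β < f n := by
    intro α
    by_cases hα : α ∈ E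
    · obtain ⟨f, hf⟩ := hlim α hα
      exact ⟨f, fun _ => hf⟩
    · exact ⟨fun _ => Classical.arbitrary W, fun h => absurd h hα⟩
  choose f hf using hchoice
  -- Otherwise each coordinate `n` is below some `b n` outside a nonstationary set. Countably many
  -- such sets have nonstationary union, so some `α ∈ E` above a bound `c` of all `b n` has its
  -- whole sequence below `c`, which is absurd.
  have hn : ∃ n, ∀ β, IsStationary {α ∈ E | β ≤ f α n} := by
    by_contra! h
    choose b hb using h
    obtain ⟨c, hc⟩ := bddAbove_range_nat hW b
    have h1 : ¬ IsStationary (⋃ n, {α ∈ E | b n ≤ f α n}) := by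
      rw [isStationary_iUnion_iff_of_countable hW.ne']
      simpa using hb
    obtain ⟨C, hC, hdisj⟩ := not_isStationary_iff.1 h1
    obtain ⟨α, hαE, hαC, hcα⟩ := hE (hC.inter hW.ne' (IsClub.Ioi c))
    obtain ⟨n, hn⟩ := (hf α hαE).2 c hcα
    exact disjoint_left.1 hdisj (mem_iUnion.2 ⟨n, hαE, (hc ⟨n, rfl⟩).trans hn.le⟩) hαC
  obtain ⟨n, hn⟩ := hn
  let Γ : Set W := {γ | IsStationary {α ∈ E | f α n = γ}}
  -- Pressing down on the points with `β ≤ f α n` yields a stationary fibre over some `γ ≥ β`. By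
  -- regularity `Γ` then has full cardinality, and fibres over distinct values are disjoint.
  have hΓ : IsCofinal Γ := by
    intro β
    obtain ⟨γ, hγ⟩ := (hn β).exists_stationary_fiber hW hI (f := fun α => f α n)
      fun α hα => (hf α hα.1).1 n
    have hmem : γ ∈ Γ := hγ.mono fun α hα => ⟨hα.1.1, hα.2⟩
    obtain ⟨α, hα⟩ := hγ.nonempty
    exact ⟨γ, hmem, by rw [← hα.2]; exact hα.1.2⟩
  have hcard : #W ≤ #Γ := hreg ▸ Order.cof_le hΓ
  obtain ⟨e⟩ := hcard
  refine ⟨fun ξ => {α ∈ E | f α n = e ξ}, fun ξ α hα => hα.1, fun ξ => (e ξ).2, ?_⟩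
  intro ξ η hne
  rw [disjoint_left]
  rintro α ⟨_, h1⟩ ⟨_, h2⟩
  exact hne (e.injective (Subtype.ext (h1.symm.trans h2)))

end WellOrder

/-! ### The ordinals below a regular cardinal -/

section Ordinal

variable {κ : Cardinal.{u}}

theorem cof_toType_ord (hreg : κ.IsRegular) : Order.cof κ.ord.ToType = κ := by
  rw [Ordinal.cof_toType, hreg.cof_ord]

theorem noMaxOrder_toType_ord (hreg : κ.IsRegular) : NoMaxOrder κ.ord.ToType := by
  have h0 : Nonempty κ.ord.ToType := Order.cof_ne_zero_iff.1 <| by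
    rw [cof_toType_ord hreg]; exact (aleph0_pos.trans_le hreg.aleph0_le).ne'
  exact (noTopOrder_iff_noMaxOrder _).1 <| Order.one_lt_cof_iff.1 <| by
    rw [cof_toType_ord hreg]; exact one_lt_aleph0.trans_le hreg.aleph0_le

theorem nonempty_toType_ord (hreg : κ.IsRegular) : Nonempty κ.ord.ToType :=
  Order.cof_ne_zero_iff.1 <| by
    rw [cof_toType_ord hreg]; exact (aleph0_pos.trans_le hreg.aleph0_le).ne'

theorem card_Iic_lt_cof (hreg : κ.IsRegular) (a : κ.ord.ToType) :
    #(Iic a) < Order.cof κ.ord.ToType := by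
  rw [cof_toType_ord hreg]
  have := noMaxOrder_toType_ord hreg
  obtain ⟨b, hb⟩ := exists_gt a
  refine (mk_le_mk_of_subset (Iic_subset_Iio.2 hb)).trans_lt ?_
  simpa using mk_Iio_lt b (by simp)

theorem mem_cofOmega_iff {α : κ.ord.ToType} : α ∈ cofOmega κ ↔ IsOmegaLimit α := by
  have : Order.cof (Iio α) = (α : Ordinal.{u}).cof := by
    rw [Order.cof_Iio]
    rfl
  rw [cofOmega, mem_ofPred_eq, ← this]
  exact ⟨isOmegaLimit_of_cof_Iio, IsOmegaLimit.cof_Iio⟩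

end Ordinal

/-! ### Compactness and weight -/

section Topology

theorem isCompact_of_finite_diff {X : Type*} [TopologicalSpace X] {V : Set X} {x : X} (hx : x ∈ V)
    (h : ∀ U, IsOpen U → x ∈ U → (V \ U).Finite) : IsCompact V := by
  classical
  refine isCompact_of_finite_subcover fun {ι} U hU hV => ?_
  obtain ⟨i, hi⟩ := mem_iUnion.1 (hV hx)
  obtain ⟨t, ht⟩ := (h (U i) (hU i) hi).isCompact.elim_finite_subcover U hU
    (sdiff_subset.trans hV)
  refine ⟨insert i t, fun y hy => ?_⟩
  by_cases hyi : y ∈ U i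
  · exact mem_biUnion (Finset.mem_insert_self i t) hyi
  · obtain ⟨j, hj, hyj⟩ := mem_iUnion₂.1 (ht ⟨hy, hyi⟩)
    exact mem_biUnion (Finset.mem_insert_of_mem hj) hyj

theorem topologicalWeight_le {X : Type u} [TopologicalSpace X] {B : Set (Set X)}
    (hB : TopologicalSpace.IsTopologicalBasis B) : topologicalWeight X ≤ #B :=
  ciInf_le' (fun B : {B : Set (Set X) // TopologicalSpace.IsTopologicalBasis B} => #B.1) ⟨B, hB⟩

theorem le_topologicalWeight {X : Type u} [TopologicalSpace X] {c : Cardinal.{u}}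
    (h : ∀ B : Set (Set X), TopologicalSpace.IsTopologicalBasis B → c ≤ #B) :
    c ≤ topologicalWeight X := by
  have : Nonempty {B : Set (Set X) // TopologicalSpace.IsTopologicalBasis B} :=
    ⟨⟨_, TopologicalSpace.isTopologicalBasis_opens⟩⟩
  exact le_ciInf fun B => h B.1 B.2

/-- Every base must contain the singleton of each isolated point. -/
theorem mk_isolatedPoints_le_topologicalWeight {X I : Type u} [TopologicalSpace X] (f : I → X)
    (hf : Function.Injective f) (ho : ∀ i, IsOpen {f i}) : #I ≤ topologicalWeight X := by
  refine le_topologicalWeight fun B hB => ?_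
  have hmem : ∀ i, {f i} ∈ B := fun i => by
    obtain ⟨v, hv, hiv, hvs⟩ := hB.exists_subset_of_mem_open (mem_singleton (f i)) (ho i)
    rwa [← subset_antisymm hvs (singleton_subset_iff.2 hiv)]
  refine mk_le_of_injective (f := fun i => (⟨{f i}, hmem i⟩ : B)) fun i j hij => ?_
  exact hf (singleton_injective (Subtype.ext_iff.1 hij))

theorem TopologicalSpace.eq_of_le_of_compact_of_t2 {X : Type*} {t₁ t₂ : TopologicalSpace X}
    (h : t₁ ≤ t₂) (h₁ : @CompactSpace X t₁) (h₂ : @T2Space X t₂) : t₁ = t₂ := by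
  refine le_antisymm h ?_
  have hc : @Continuous X X t₁ t₂ id := continuous_id_iff_le.2 h
  have hcl : @IsClosedMap X X t₁ t₂ id := @Continuous.isClosedMap X X t₁ t₂ h₁ h₂ id hc
  intro s hs
  have := hcl sᶜ ((@isClosed_compl_iff X t₁ s).2 hs)
  rw [image_id] at this
  exact (@isClosed_compl_iff X t₂ s).1 this

/-- A compact space whose points are separated by an infinite family of clopen sets has weight at
most the cardinality of the family. -/
theorem topologicalWeight_le_of_separating {X I : Type u} [TopologicalSpace X] [CompactSpace X]
    [Infinite I] (V : I → Set X) (hV : ∀ i, IsClopen (V i))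
    (hsep : ∀ x y, x ≠ y → ∃ i, (x ∈ V i ∧ y ∉ V i) ∨ (y ∈ V i ∧ x ∉ V i)) :
    topologicalWeight X ≤ #I := by
  let s : Set (Set X) := range V ∪ range fun i => (V i)ᶜ
  have hle : ‹TopologicalSpace X› ≤ TopologicalSpace.generateFrom s := by
    refine le_generateFrom ?_
    rintro _ (⟨i, rfl⟩ | ⟨i, rfl⟩)
    · exact (hV i).isOpen
    · exact (hV i).compl.isOpen
  have ho : ∀ i, @IsOpen X (TopologicalSpace.generateFrom s) (V i) := fun i =>
    TopologicalSpace.isOpen_generateFrom_of_mem (Or.inl ⟨i, rfl⟩)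
  have ho' : ∀ i, @IsOpen X (TopologicalSpace.generateFrom s) (V i)ᶜ := fun i =>
    TopologicalSpace.isOpen_generateFrom_of_mem (Or.inr ⟨i, rfl⟩)
  have ht2 : @T2Space X (TopologicalSpace.generateFrom s) := by
    refine @T2Space.mk X (TopologicalSpace.generateFrom s) fun x y hxy => ?_
    obtain ⟨i, ⟨hx, hy⟩ | ⟨hy, hx⟩⟩ := hsep x y hxy
    · exact ⟨V i, (V i)ᶜ, ho i, ho' i, hx, hy, disjoint_compl_right⟩
    · exact ⟨(V i)ᶜ, V i, ho' i, ho i, hx, hy, disjoint_compl_left⟩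
  -- The sets and their complements generate a coarser Hausdorff topology, so by compactness they
  -- generate the original one; finite intersections then form a base.
  have heq := TopologicalSpace.eq_of_le_of_compact_of_t2 hle inferInstance ht2
  refine (topologicalWeight_le (TopologicalSpace.isTopologicalBasis_of_subbasis heq)).trans ?_
  have hs : #s ≤ #I := by
    refine (mk_union_le _ _).trans ((add_le_add mk_range_le mk_range_le).trans ?_)
    rw [add_eq_self (aleph0_le_mk I)]
  have hsub : (fun f : Set (Set X) => ⋂₀ f) '' {f | f.Finite ∧ f ⊆ s} ⊆
      range fun t : Finset s => ⋂₀ ((↑) '' (t : Set s)) := by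
    rintro _ ⟨f, ⟨hf, hfs⟩, rfl⟩
    lift f to Set s using hfs
    have hf' : f.Finite := hf.of_finite_image Subtype.val_injective.injOn
    exact ⟨hf'.toFinset, by simp⟩
  refine (mk_le_mk_of_subset hsub).trans (mk_range_le.trans ?_)
  rcases finite_or_infinite s with hfin | hinf
  · exact (lt_aleph0_of_finite _).le.trans (aleph0_le_mk I)
  · rwa [mk_finset_of_infinite]

end Topology

/-! ### Topology of ladder system spaces -/

namespace LadderSystem

variable {κ : Cardinal.{u}} (L : LadderSystem κ) {S : Set κ.ord.ToType}

/-- Ladders consist of successors, so their points are isolated in every X_S with S ⊆ E^κ_ω. -/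
theorem notMem_cofOmega_of_mem_ladder {α γ : κ.ord.ToType} (hα : α ∈ cofOmega κ)
    (hγ : γ ∈ L.ladder α) : γ ∉ cofOmega κ := by
  obtain ⟨β, hβ, rfl⟩ := L.subset_succ α hα hγ
  intro h
  obtain ⟨δ, h1, h2⟩ := (mem_cofOmega_iff.1 h).exists_between
    (Order.lt_succ_of_not_isMax (not_isMax_of_lt hβ))
  exact (Order.succ_le_of_lt h1).not_gt h2

theorem lt_of_mem_ladder {α γ : κ.ord.ToType} (hα : α ∈ cofOmega κ)
    (hγ : γ ∈ L.ladder α) : γ < α :=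
  ((L.isLUB α hα).1 hγ).lt_of_ne fun h => L.notMem_cofOmega_of_mem_ladder hα hγ (h ▸ hα)

theorem infinite_ladder {α : κ.ord.ToType} (hα : α ∈ cofOmega κ) : (L.ladder α).Infinite := by
  intro hfin
  obtain ⟨f, hf, -⟩ := mem_cofOmega_iff.1 hα
  have hne : (L.ladder α).Nonempty := by
    by_contra! h
    have := L.isLUB α hα
    rw [h] at this
    exact (this.2 (by simp : f 0 ∈ upperBounds ∅)).not_gt (hf 0)
  obtain ⟨m, hm, hmax⟩ := hfin.exists_maximalFor id _ hne
  have hub : m ∈ upperBounds (L.ladder α) := fun x hx => by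
    rcases le_total x m with h | h
    · exact h
    · exact hmax hx h
  exact ((L.isLUB α hα).2 hub).not_gt (L.lt_of_mem_ladder hα hm)

theorem exists_ladderSystem : Nonempty (LadderSystem κ) := by
  have hchoice : ∀ α : κ.ord.ToType, ∃ A : Set κ.ord.ToType, α ∈ cofOmega κ →
      A ⊆ {γ | ∃ β < α, γ = Order.succ β} ∧ (∀ β < α, (A ∩ Iio β).Finite) ∧ IsLUB A α := by
    intro α
    by_cases hα : α ∈ cofOmega κ
    · obtain ⟨f, hf, hcof⟩ := mem_cofOmega_iff.1 hα
      have hg : ∀ n, partialSups f n < α := by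
        intro n
        induction n with
        | zero => simpa using hf 0
        -- Partial suprema make the sequence monotone, so only finitely many terms lie below a given
        -- `β < α`.
        | succ n ih => rw [partialSups_add_one]; exact max_lt ih (hf _)
      refine ⟨range fun n => Order.succ (partialSups f n), fun _ => ⟨?_, ?_, ?_, ?_⟩⟩
      · rintro _ ⟨n, rfl⟩
        exact ⟨_, hg n, rfl⟩
      · intro β hβ
        obtain ⟨n, hn⟩ := hcof β hβ
        refine ((finite_Iio n).image fun n => Order.succ (partialSups f n)).subset ?_
        rintro _ ⟨⟨m, rfl⟩, hm⟩
        refine ⟨m, ?_, rfl⟩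
        by_contra h
        have h1 : f n ≤ partialSups f m := le_partialSups_of_le f (not_lt.1 h)
        exact (hn.trans_le (h1.trans (Order.le_succ _))).not_gt hm
      · rintro _ ⟨n, rfl⟩
        exact Order.succ_le_of_lt (hg n)
      · intro b hb
        by_contra! h
        obtain ⟨n, hn⟩ := hcof b h
        exact (hn.trans_le ((le_partialSups f n).trans (Order.le_succ _))).not_ge (hb ⟨n, rfl⟩)
    · exact ⟨∅, fun h => absurd h hα⟩
  choose A hA using hchoice
  exact ⟨⟨A, fun α hα => (hA α hα).1, fun α hα => (hA α hα).2.1, fun α hα => (hA α hα).2.2⟩⟩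

/-- An ordinal below `κ` as a point of the ladder system space. -/
abbrev pt (L : LadderSystem κ) (S : Set κ.ord.ToType) (γ : κ.ord.ToType) : L.Space S := γ

theorem isOpen_space_iff {U : Set κ.ord.ToType} :
    IsOpen (X := L.Space S) U ↔ ∀ α ∈ S, α ∈ U →
      ∃ F : Set κ.ord.ToType, F.Finite ∧ F ⊆ L.ladder α ∧ (L.ladder α \ F) ∪ {α} ⊆ U :=
  Iff.rfl

/-- The basic compact open neighbourhood of a point of the ladder system space. -/
def basicNhd (L : LadderSystem κ) (S : Set κ.ord.ToType) (γ : κ.ord.ToType) : Set (L.Space S) :=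
  {x : κ.ord.ToType | x = γ ∨ (γ ∈ S ∧ x ∈ L.ladder γ)}

theorem self_mem_basicNhd (γ : κ.ord.ToType) : L.pt S γ ∈ L.basicNhd S γ :=
  Or.inl rfl

theorem le_of_mem_basicNhd (hS : S ⊆ cofOmega κ) {x γ : κ.ord.ToType}
    (h : L.pt S x ∈ L.basicNhd S γ) : x ≤ γ := by
  rcases h with h | ⟨hγ, hx⟩
  · exact h.le
  · exact (L.lt_of_mem_ladder (hS hγ) hx).le

theorem eq_of_mem_basicNhd (hS : S ⊆ cofOmega κ) {x γ : κ.ord.ToType}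
    (h : L.pt S x ∈ L.basicNhd S γ) (hx : x ∈ S) : x = γ := by
  rcases h with h | ⟨hγ, hxγ⟩
  · exact h
  · exact absurd (hS hx) (L.notMem_cofOmega_of_mem_ladder (hS hγ) hxγ)

theorem isOpen_basicNhd (hS : S ⊆ cofOmega κ) (γ : κ.ord.ToType) :
    IsOpen (L.basicNhd S γ) := by
  refine L.isOpen_space_iff.2 fun α hα hαγ => ?_
  obtain rfl := L.eq_of_mem_basicNhd hS hαγ hα
  refine ⟨∅, finite_empty, empty_subset _, ?_⟩
  rintro x (hx | hx)
  · exact Or.inr ⟨hα, hx.1⟩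
  · exact Or.inl hx

theorem isOpen_singleton (S : Set κ.ord.ToType) {γ : κ.ord.ToType} (hγ : γ ∉ S) :
    IsOpen ({γ} : Set (L.Space S)) := by
  refine L.isOpen_space_iff.2 fun α hα hαγ => ?_
  obtain rfl : α = γ := hαγ
  exact absurd hα hγ

theorem isClosed_of_finite_inter {V : Set κ.ord.ToType}
    (h : ∀ α ∈ S, α ∉ V → (L.ladder α ∩ V).Finite) : IsClosed (X := L.Space S) V := by
  refine isOpen_compl_iff.1 ?_
  refine L.isOpen_space_iff.2 fun α hα hαV => ?_
  refine ⟨L.ladder α ∩ V, h α hα hαV, inter_subset_left, ?_⟩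
  rintro x (hx | hx)
  · exact fun hxV => hx.2 ⟨hx.1, hxV⟩
  · obtain rfl : x = α := hx
    exact hαV

/-- Two ladders at different points meet in a finite set, because the ladder with the larger top has
only finitely many points below the smaller one. -/
theorem isClosed_basicNhd (hS : S ⊆ cofOmega κ) (γ : κ.ord.ToType) :
    IsClosed (L.basicNhd S γ) := by
  refine L.isClosed_of_finite_inter fun α hα hαγ => ?_
  rcases lt_trichotomy α γ with h | h | h
  · by_cases hγ : γ ∈ S
    · refine (L.finite_inter γ (hS hγ) α h).subset ?_
      rintro x ⟨hx, hx'⟩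
      have hxα := L.lt_of_mem_ladder (hS hα) hx
      rcases hx' with rfl | hx'
      · exact absurd h hxα.not_gt
      · exact ⟨hx'.2, hxα⟩
    · refine (finite_singleton γ).subset ?_
      rintro x ⟨-, hx | hx⟩
      · exact hx
      · exact absurd hx.1 hγ
  · subst h
    exact absurd (L.self_mem_basicNhd α) hαγ
  · refine ((L.finite_inter α (hS hα) γ h).union (finite_singleton γ)).subset ?_
    rintro x ⟨hx, hx'⟩
    rcases (L.le_of_mem_basicNhd hS hx').lt_or_eq with hlt | heq
    · exact Or.inl ⟨hx, hlt⟩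
    · exact Or.inr heq

theorem isClopen_basicNhd (hS : S ⊆ cofOmega κ) (γ : κ.ord.ToType) :
    IsClopen (L.basicNhd S γ) :=
  ⟨L.isClosed_basicNhd hS γ, L.isOpen_basicNhd hS γ⟩

theorem isCompact_basicNhd (γ : κ.ord.ToType) : IsCompact (L.basicNhd S γ) := by
  refine isCompact_of_finite_diff (L.self_mem_basicNhd γ) fun U hU hγ => ?_
  by_cases hγS : γ ∈ S
  · obtain ⟨F, hF, -, hFU⟩ := L.isOpen_space_iff.1 hU γ hγS hγ
    refine hF.subset ?_
    rintro x ⟨hx | hx, hxU⟩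
    · exact absurd (hFU (Or.inr hx)) hxU
    · by_contra hxF
      exact hxU (hFU (Or.inl ⟨hx.2, hxF⟩))
  · refine finite_empty.subset ?_
    rintro x ⟨hx | hx, hxU⟩
    · exact hxU (hx ▸ hγ)
    · exact hγS hx.1

/-- Only a ladder with top `δ` could accumulate at the boundary of the segment, and `δ ∉ S` rules
that out. -/
theorem isClopen_Iio (hS : S ⊆ cofOmega κ) {δ : κ.ord.ToType} (hδ : δ ∉ S) :
    IsClopen (X := L.Space S) (Iio δ : Set κ.ord.ToType) := by
  refine ⟨L.isClosed_of_finite_inter fun α hα hαδ => ?_, L.isOpen_space_iff.2 fun α hα hαδ => ?_⟩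
  · have hδα : δ < α := (not_lt.1 hαδ).lt_of_ne fun h => hδ (h ▸ hα)
    exact L.finite_inter α (hS hα) δ hδα
  · refine ⟨∅, finite_empty, empty_subset _, ?_⟩
    rintro x (hx | hx)
    · exact (L.lt_of_mem_ladder (hS hα) hx.1).trans hαδ
    · obtain rfl : x = α := hx
      exact hαδ

/-- Finitely many basic neighbourhoods centred in `K` cover `K`, and each has its centre as maximum.
-/
theorem exists_isGreatest_of_isCompact (hS : S ⊆ cofOmega κ) {K : Set κ.ord.ToType}
    (hK : IsCompact (X := L.Space S) K) (hne : K.Nonempty) : ∃ m, IsGreatest K m := by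
  obtain ⟨t, htK, ht⟩ := hK.elim_nhds_subcover (fun γ => L.basicNhd S γ)
    fun γ _ => (L.isOpen_basicNhd hS γ).mem_nhds (L.self_mem_basicNhd γ)
  have htne : t.Nonempty := by
    obtain ⟨x, hx⟩ := hne
    obtain ⟨γ, hγ, -⟩ := mem_iUnion₂.1 (ht hx)
    exact ⟨γ, hγ⟩
  obtain ⟨m, hm, hmax⟩ := t.finite_toSet.exists_maximalFor
    (id : κ.ord.ToType → κ.ord.ToType) _ htne
  refine ⟨m, htK m hm, fun x hx => ?_⟩
  obtain ⟨γ, hγ, hxγ⟩ := mem_iUnion₂.1 (ht hx)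
  refine (L.le_of_mem_basicNhd hS hxγ).trans ?_
  rcases le_total (α := κ.ord.ToType) γ m with h | h
  · exact h
  · exact hmax hγ h

theorem t2Space (hS : S ⊆ cofOmega κ) : T2Space (L.Space S) := by
  have key : ∀ x y : κ.ord.ToType, x < y → ∃ U V : Set (L.Space S),
      IsOpen U ∧ IsOpen V ∧ L.pt S x ∈ U ∧ L.pt S y ∈ V ∧
        Disjoint U V := fun x y h =>
    ⟨_, _, L.isOpen_basicNhd hS x, (L.isClosed_basicNhd hS x).isOpen_compl,
      L.self_mem_basicNhd x, fun hy => (L.le_of_mem_basicNhd hS hy).not_gt h, disjoint_compl_right⟩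
  refine ⟨fun x y hxy => ?_⟩
  rcases lt_or_gt_of_ne (α := κ.ord.ToType) (a := x) (b := y) hxy with h | h
  · exact key x y h
  · obtain ⟨U, V, hU, hV, hx, hy, hd⟩ := key y x h
    exact ⟨V, U, hV, hU, hy, hx, hd.symm⟩

theorem weaklyLocallyCompactSpace (hS : S ⊆ cofOmega κ) :
    WeaklyLocallyCompactSpace (L.Space S) :=
  ⟨fun x => ⟨L.basicNhd S x, L.isCompact_basicNhd x,
    (L.isOpen_basicNhd hS x).mem_nhds (L.self_mem_basicNhd x)⟩⟩

theorem t2Space_KL (hS : S ⊆ cofOmega κ) : T2Space (L.KL S) :=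
  have := L.t2Space hS
  have := L.weaklyLocallyCompactSpace hS
  inferInstance

theorem topologicalWeight_KL (hreg : κ.IsRegular) (hS : S ⊆ cofOmega κ) :
    topologicalWeight (L.KL S) = κ := by
  have := noMaxOrder_toType_ord hreg
  have := nonempty_toType_ord hreg
  refine le_antisymm ?_ ?_
  · have hinf : Infinite κ.ord.ToType := NoMaxOrder.infinite
    refine (topologicalWeight_le_of_separating (I := κ.ord.ToType)
      (fun γ => ((↑) : L.Space S → L.KL S) '' L.basicNhd S γ) ?_ ?_).trans (by simp)
    · refine fun γ => ⟨?_, OnePoint.isOpenEmbedding_coe.isOpenMap _ (L.isOpen_basicNhd hS γ)⟩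
      rw [OnePoint.isClosed_image_coe]
      exact ⟨L.isClosed_basicNhd hS γ, L.isCompact_basicNhd γ⟩
    · have hmem : ∀ x γ : κ.ord.ToType, (L.pt S x : L.KL S) ∈
          ((↑) : L.Space S → L.KL S) '' L.basicNhd S γ → x ≤ γ := by
        rintro x γ ⟨y, hy, hyx⟩
        obtain rfl := OnePoint.coe_injective hyx
        exact L.le_of_mem_basicNhd hS hy
      have hself : ∀ γ : κ.ord.ToType, (L.pt S γ : L.KL S) ∈
          ((↑) : L.Space S → L.KL S) '' L.basicNhd S γ :=
        fun γ => ⟨γ, L.self_mem_basicNhd γ, rfl⟩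
      intro x y hxy
      induction x using OnePoint.rec with
      | infty =>
        induction y using OnePoint.rec with
        | infty => exact absurd rfl hxy
        | coe y => exact ⟨y, Or.inr ⟨hself y, OnePoint.infty_notMem_image_coe⟩⟩
      | coe x =>
        induction y using OnePoint.rec with
        | infty => exact ⟨x, Or.inl ⟨hself x, OnePoint.infty_notMem_image_coe⟩⟩
        | coe y =>
          rcases lt_or_gt_of_ne (α := κ.ord.ToType) (a := x) (b := y) fun h => hxy (congrArg _ h) with h | h
          · exact ⟨x, Or.inl ⟨hself x, fun hy => (hmem _ _ hy).not_gt h⟩⟩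
          · exact ⟨y, Or.inr ⟨hself y, fun hx => (hmem _ _ hx).not_gt h⟩⟩
  · refine le_of_eq_of_le (by simp) (mk_isolatedPoints_le_topologicalWeight
      (fun γ : κ.ord.ToType => (L.pt S (Order.succ γ) : L.KL S)) ?_ ?_)
    · intro a b hab
      exact Order.succ_injective (OnePoint.coe_injective hab)
    · intro γ
      rw [← image_singleton]
      refine OnePoint.isOpenEmbedding_coe.isOpenMap _ (L.isOpen_singleton S fun h => ?_)
      obtain ⟨δ, h1, h2⟩ := (mem_cofOmega_iff.1 (hS h)).exists_between (Order.lt_succ γ)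
      exact (Order.succ_le_of_lt h1).not_gt h2

end LadderSystem

/-! ### C₀(X) and its relation to C of the one-point compactification -/

section ZeroAtInfty

open Filter Topology

variable {X : Type*} [TopologicalSpace X]

namespace ZeroAtInftyContinuousMap

theorem abs_apply_le_norm (f : C₀(X, ℝ)) (x : X) : |f x| ≤ ‖f‖ := by
  rw [← norm_toBCF_eq_norm]
  exact f.toBCF.norm_coe_le_norm x

theorem norm_le_of_forall_abs_le {f : C₀(X, ℝ)} {c : ℝ} (hc : 0 ≤ c) (h : ∀ x, |f x| ≤ c) :
    ‖f‖ ≤ c := by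
  rw [← norm_toBCF_eq_norm]
  exact (BoundedContinuousFunction.norm_le hc).2 h

theorem isCompact_le_abs (f : C₀(X, ℝ)) {ε : ℝ} (hε : 0 < ε) : IsCompact {x | ε ≤ |f x|} := by
  have h : ∀ᶠ x in cocompact X, |f x| < ε := by
    filter_upwards [(zero_at_infty f).eventually (Metric.ball_mem_nhds 0 hε)] with x hx
    simpa using hx
  obtain ⟨t, ht, hts⟩ := mem_cocompact'.1 h
  refine ht.of_isClosed_subset (isClosed_le continuous_const (map_continuous f).abs) ?_
  exact fun x (hx : ε ≤ |f x|) => hts fun h' : |f x| < ε => hx.not_gt h'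

/-- Evaluation at a point as a continuous functional. -/
noncomputable def evalCLM (x : X) : C₀(X, ℝ) →L[ℝ] ℝ :=
  LinearMap.mkContinuous
    { toFun := fun f => f x
      map_add' := fun _ _ => rfl
      map_smul' := fun _ _ => rfl } 1
    fun f => by simpa using abs_apply_le_norm f x

@[simp]
theorem evalCLM_apply (x : X) (f : C₀(X, ℝ)) : evalCLM x f = f x := rfl

/-- The restriction of a function to a clopen set, extended by zero. -/
noncomputable def clopenIndicator {U : Set X} (hU : IsClopen U) (f : C₀(X, ℝ)) : C₀(X, ℝ) where
  toFun := U.indicator f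
  continuous_toFun := (map_continuous f).indicator fun a ha => by simp [hU.frontier_eq] at ha
  zero_at_infty' := by
    refine squeeze_zero_norm (fun x => norm_indicator_le_norm_self f x) ?_
    simpa using (zero_at_infty f).norm

theorem clopenIndicator_of_notMem {U : Set X} (hU : IsClopen U) (f : C₀(X, ℝ)) {x : X}
    (hx : x ∉ U) : clopenIndicator hU f x = 0 :=
  indicator_of_notMem hx f

theorem clopenIndicator_add_compl {U : Set X} (hU : IsClopen U) (f : C₀(X, ℝ)) :
    clopenIndicator hU f + clopenIndicator hU.compl f = f :=
  ext fun x => congrFun (indicator_self_add_compl U f) x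

/-- The characteristic function of a compact clopen set. -/
noncomputable def compactIndicator {U : Set X} (hU : IsClopen U) (hK : IsCompact U) :
    C₀(X, ℝ) where
  toFun := U.indicator 1
  continuous_toFun := continuous_one.indicator fun a ha => by simp [hU.frontier_eq] at ha
  zero_at_infty' := by
    refine tendsto_const_nhds.congr' ?_
    filter_upwards [hK.compl_mem_cocompact] with x hx
    exact (indicator_of_notMem hx _).symm

theorem compactIndicator_apply {U : Set X} (hU : IsClopen U) (hK : IsCompact U) (x : X) :
    compactIndicator hU hK x = U.indicator 1 x := rfl

variable [T2Space X]

/-- Extension by zero to the one-point compactification. -/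
noncomputable def toOnePoint : C₀(X, ℝ) →L[ℝ] C(OnePoint X, ℝ) :=
  LinearMap.mkContinuous
    { toFun := fun f => OnePoint.continuousMapMk f.toContinuousMap 0
        (by simpa [coclosedCompact_eq_cocompact] using zero_at_infty f)
      map_add' := fun f g => by
        ext x
        induction x using OnePoint.rec with
        | infty => exact (add_zero (0 : ℝ)).symm
        | coe x => rfl
      map_smul' := fun c f => by
        ext x
        induction x using OnePoint.rec with
        | infty => exact (mul_zero c).symm
        | coe x => rfl } 1
    fun f => by
      rw [one_mul, ContinuousMap.norm_le _ (norm_nonneg f)]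
      intro x
      induction x using OnePoint.rec with
      | infty => exact norm_zero.trans_le (norm_nonneg f)
      | coe x => exact abs_apply_le_norm f x

/-- Subtraction of the value at infinity, as an operator from the continuous functions on the
one-point compactification. -/
noncomputable def ofOnePoint : C(OnePoint X, ℝ) →L[ℝ] C₀(X, ℝ) :=
  LinearMap.mkContinuous
    { toFun := fun f =>
        { toFun := fun x => f x - f OnePoint.infty
          continuous_toFun := (f.continuous.comp OnePoint.continuous_coe).sub continuous_const
          zero_at_infty' := by
            have h : Tendsto (fun x : X => f x) (cocompact X) (𝓝 (f OnePoint.infty)) := by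
              rw [← coclosedCompact_eq_cocompact]
              exact (f.continuous.tendsto _).comp OnePoint.tendsto_coe_infty
            simpa using h.sub_const (f OnePoint.infty) }
      map_add' := fun f g => by
        ext x
        exact add_sub_add_comm _ _ _ _
      map_smul' := fun c f => by
        ext x
        exact (mul_sub c _ _).symm } 2
    fun f => by
      refine norm_le_of_forall_abs_le (by positivity) fun x => ?_
      refine (abs_sub _ _).trans ?_
      rw [two_mul]
      exact add_le_add (f.norm_coe_le_norm _) (f.norm_coe_le_norm _)

theorem toOnePoint_ofOnePoint (f : C(OnePoint X, ℝ)) :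
    toOnePoint (ofOnePoint f) + f OnePoint.infty • (1 : C(OnePoint X, ℝ)) = f := by
  ext x
  induction x using OnePoint.rec with
  | infty =>
    change 0 + f OnePoint.infty * 1 = _
    ring
  | coe x =>
    change f x - f OnePoint.infty + f OnePoint.infty * 1 = _
    ring

end ZeroAtInftyContinuousMap

end ZeroAtInfty

/-! ### Functionals and operators on C₀(X_S) -/

namespace LadderSystem

open ZeroAtInftyContinuousMap

variable {κ : Cardinal.{u}} (L : LadderSystem κ) {R S : Set κ.ord.ToType}

/-- The characteristic function of a basic compact open neighbourhood. -/
noncomputable def basicFun (hS : S ⊆ cofOmega κ) (γ : κ.ord.ToType) : C₀(L.Space S, ℝ) :=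
  compactIndicator (L.isClopen_basicNhd hS γ) (L.isCompact_basicNhd γ)

theorem basicFun_self (hS : S ⊆ cofOmega κ) (γ : κ.ord.ToType) :
    L.basicFun hS γ (L.pt S γ) = 1 := by
  rw [basicFun, compactIndicator_apply, indicator_of_mem (L.self_mem_basicNhd γ), Pi.one_apply]

theorem basicFun_of_lt (hS : S ⊆ cofOmega κ) {γ x : κ.ord.ToType} (h : γ < x) :
    L.basicFun hS γ (L.pt S x) = 0 := by
  rw [basicFun, compactIndicator_apply, indicator_of_notMem]
  exact fun hx => (L.le_of_mem_basicNhd hS hx).not_gt h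

theorem exists_support_bound (hreg : κ.IsRegular) (hunc : ℵ₀ < κ) (hS : S ⊆ cofOmega κ)
    (f : C₀(L.Space S, ℝ)) : ∃ b : κ.ord.ToType, ∀ x, b < x → f (L.pt S x) = 0 := by
  have := nonempty_toType_ord hreg
  have h : ∀ n : ℕ, ∃ b : κ.ord.ToType, ∀ x : κ.ord.ToType,
      1 / ((n : ℝ) + 1) ≤ |f (L.pt S x)| → x ≤ b := by
    intro n
    have hK := f.isCompact_le_abs (Nat.one_div_pos_of_nat (α := ℝ) (n := n))
    rcases ({x | 1 / ((n : ℝ) + 1) ≤ |f x|} : Set (L.Space S)).eq_empty_or_nonempty with he | hne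
    · exact ⟨Classical.arbitrary _, fun x hx => (eq_empty_iff_forall_notMem.1 he (L.pt S x) hx).elim⟩
    · obtain ⟨m, -, hm⟩ := L.exists_isGreatest_of_isCompact hS hK hne
      exact ⟨m, fun x hx => hm hx⟩
  choose b hb using h
  obtain ⟨c, hc⟩ := bddAbove_range_nat (by rwa [cof_toType_ord hreg]) b
  refine ⟨c, fun x hx => ?_⟩
  by_contra hne
  obtain ⟨n, hn⟩ := exists_nat_one_div_lt (abs_pos.2 hne)
  exact ((hb n x hn.le).trans (hc ⟨n, rfl⟩)).not_gt hx

/-- Every functional on `C₀(X_S)` vanishes on the functions supported above some ordinal. -/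
theorem exists_functional_bound (hreg : κ.IsRegular) (hunc : ℵ₀ < κ) (hS : S ⊆ cofOmega κ)
    (μ : C₀(L.Space S, ℝ) →L[ℝ] ℝ) : ∃ b : κ.ord.ToType, ∀ f : C₀(L.Space S, ℝ),
      (∀ x ≤ b, f (L.pt S x) = 0) → μ f = 0 := by
  have h : ∀ n : ℕ, ∃ f : C₀(L.Space S, ℝ), ‖f‖ ≤ 1 ∧ ‖μ‖ - 1 / ((n : ℝ) + 1) < |μ f| := by
    intro n
    obtain ⟨f, hf, hμ⟩ := μ.exists_lt_apply_of_lt_opNorm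
      (sub_lt_self ‖μ‖ (Nat.one_div_pos_of_nat (α := ℝ) (n := n)))
    exact ⟨f, hf.le, hμ⟩
  choose F hF hμF using h
  choose c hc using fun n => L.exists_support_bound hreg hunc hS (F n)
  -- Above `b` all the almost norming functions `F n` vanish. If `g` in the unit ball lives above
  -- `b`, then `F n ± g` stays in the unit ball, so |μ (F n)| + |μ g| ≤ ‖μ‖, forcing μ g = 0.
  obtain ⟨b, hb⟩ := bddAbove_range_nat (by rwa [cof_toType_ord hreg]) c
  have key : ∀ g : C₀(L.Space S, ℝ), ‖g‖ ≤ 1 → (∀ x ≤ b, g (L.pt S x) = 0) → μ g = 0 := by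
    intro g hg hgb
    by_contra hne
    obtain ⟨n, hn⟩ := exists_nat_one_div_lt (abs_pos.2 hne)
    have hle : ∀ s : ℝ, |s| = 1 → |μ (F n) + s * μ g| ≤ ‖μ‖ := by
      intro s hs
      have h1 : ‖F n + s • g‖ ≤ 1 := by
        refine norm_le_of_forall_abs_le zero_le_one fun x => ?_
        rw [ZeroAtInftyContinuousMap.add_apply, ZeroAtInftyContinuousMap.smul_apply, smul_eq_mul]
        rcases le_or_gt (α := κ.ord.ToType) x b with hx | hx
        · rw [hgb x hx, mul_zero, add_zero]
          exact (abs_apply_le_norm _ _).trans (hF n)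
        · rw [hc n x ((hb ⟨n, rfl⟩).trans_lt hx), zero_add, abs_mul, hs, one_mul]
          exact (abs_apply_le_norm _ _).trans hg
      have h2 := μ.le_of_opNorm_le le_rfl (F n + s • g)
      rw [map_add, map_smul, smul_eq_mul, Real.norm_eq_abs] at h2
      exact h2.trans (mul_le_of_le_one_right (norm_nonneg μ) h1)
    have h1 := hle 1 (by simp)
    have h2 := hle (-1) (by simp)
    have h3 := hμF n
    have : |μ (F n)| + |μ g| ≤ ‖μ‖ := by
      rw [abs_le] at h1 h2
      rcases abs_cases (μ (F n)) with ⟨h, _⟩ | ⟨h, _⟩ <;>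
        rcases abs_cases (μ g) with ⟨h', _⟩ | ⟨h', _⟩ <;> rw [h, h'] <;> linarith
    linarith
  refine ⟨b, fun f hf => ?_⟩
  rcases eq_or_ne f 0 with rfl | hne
  · exact map_zero μ
  have hpos : 0 < ‖f‖ := norm_pos_iff.2 hne
  have h := key (‖f‖⁻¹ • f) (by rw [norm_smul, norm_inv, norm_norm, inv_mul_cancel₀ hpos.ne'])
    fun x hx => by rw [ZeroAtInftyContinuousMap.smul_apply, hf x hx, smul_zero]
  rw [map_smul, smul_eq_mul] at h
  exact (mul_eq_zero.1 h).resolve_left (inv_ne_zero hpos.ne')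

/-- The compact set {|f| ≥ ε} has a greatest point `a`. Subtracting `f a` times the basic function
at `a` leaves `μ f` unchanged and pushes this set strictly below `a`; well-foundedness ends the
descent with the set empty. -/
theorem abs_functional_le_of_basicFun (hS : S ⊆ cofOmega κ) (μ : C₀(L.Space S, ℝ) →L[ℝ] ℝ)
    {ε : ℝ} (hε : 0 < ε) (m : κ.ord.ToType) (hm : ∀ γ < m, μ (L.basicFun hS γ) = 0)
    (f : C₀(L.Space S, ℝ)) (hf : ∀ x : κ.ord.ToType, ε ≤ |f (L.pt S x)| → x < m) :
    |μ f| ≤ ‖μ‖ * ε := by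
  induction m using WellFoundedLT.induction generalizing f with
  | ind m ih =>
  rcases ({x | ε ≤ |f x|} : Set (L.Space S)).eq_empty_or_nonempty with he | hne
  · refine μ.le_opNorm_of_le (norm_le_of_forall_abs_le hε.le fun x => ?_)
    by_contra! h
    exact eq_empty_iff_forall_notMem.1 he x h.le
  · obtain ⟨a, ha, hmax⟩ := L.exists_isGreatest_of_isCompact hS (f.isCompact_le_abs hε) hne
    have ham := hf a ha
    have h := ih a ham (fun γ hγ => hm γ (hγ.trans ham))
      (f - f (L.pt S a) • L.basicFun hS a) fun x hx => ?_
    · rwa [map_sub, map_smul, hm a ham, smul_zero, sub_zero] at h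
    · rw [ZeroAtInftyContinuousMap.sub_apply, ZeroAtInftyContinuousMap.smul_apply, smul_eq_mul] at hx
      rcases lt_trichotomy x a with hxa | rfl | hxa
      · exact hxa
      · rw [basicFun_self, mul_one, sub_self, abs_zero] at hx
        exact absurd hx hε.not_ge
      · rw [basicFun_of_lt L hS hxa, mul_zero, sub_zero] at hx
        exact absurd hxa (not_lt.2 (hmax hx))

theorem functional_eq_zero_of_basicFun (hS : S ⊆ cofOmega κ) (μ : C₀(L.Space S, ℝ) →L[ℝ] ℝ)
    (m : κ.ord.ToType) (hm : ∀ γ < m, μ (L.basicFun hS γ) = 0)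
    (f : C₀(L.Space S, ℝ)) (hf : ∀ x, m ≤ x → f (L.pt S x) = 0) : μ f = 0 := by
  by_contra hne
  have hμ : 0 < ‖μ‖ + 1 := by positivity
  -- This `ε` satisfies ‖μ‖ ε < |μ f|, contradicting the previous bound.
  have hε : 0 < |μ f| / (‖μ‖ + 1) := div_pos (abs_pos.2 hne) hμ
  have h := L.abs_functional_le_of_basicFun hS μ hε m hm f fun x hx => by
    by_contra! hmx
    rw [hf x hmx, abs_zero] at hx
    exact hx.not_gt hε
  rw [← mul_div_assoc, le_div_iff₀ hμ] at h
  have := abs_pos.2 hne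
  linarith

/-- The ladder at `δ` is infinite, lies below `δ` and converges to `δ`. -/
theorem apply_eq_zero_of_forall_lt (hS : S ⊆ cofOmega κ) {δ : κ.ord.ToType} (hδ : δ ∈ S)
    (f : C₀(L.Space S, ℝ)) (hf : ∀ x < δ, f (L.pt S x) = 0) : f (L.pt S δ) = 0 := by
  by_contra hne
  obtain ⟨F, hF, -, hFU⟩ := L.isOpen_space_iff.1
    ((isOpen_compl_singleton (x := (0 : ℝ))).preimage (map_continuous f)) δ hδ hne
  obtain ⟨x, hx, hxF⟩ := ((L.infinite_ladder (hS hδ)).sdiff hF).nonempty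
  exact hFU (Or.inl ⟨hx, hxF⟩) (hf x (L.lt_of_mem_ladder (hS hδ) hx))

/-- If `S \ R` is stationary, then all functions in the range of an operator
`C₀(X_R) → C₀(X_S)`, together with a further function, vanish at some point of `S`. -/
theorem exists_common_zero (hreg : κ.IsRegular) (hunc : ℵ₀ < κ) (hR : R ⊆ cofOmega κ)
    (hS : S ⊆ cofOmega κ) (hst : IsStationary (S \ R))
    (T : C₀(L.Space R, ℝ) →L[ℝ] C₀(L.Space S, ℝ)) (h : C₀(L.Space S, ℝ)) :
    ∃ δ ∈ S, (∀ f, T f (L.pt S δ) = 0) ∧ h (L.pt S δ) = 0 := by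
  have := noMaxOrder_toType_ord hreg
  have hW : ℵ₀ < Order.cof κ.ord.ToType := by rwa [cof_toType_ord hreg]
  choose b hb using fun γ => L.exists_support_bound hreg hunc hS (T (L.basicFun hR γ))
  choose c hc using fun γ : κ.ord.ToType =>
    L.exists_functional_bound hreg hunc hR ((evalCLM (L.pt S γ)).comp T)
  obtain ⟨d, hd⟩ := L.exists_support_bound hreg hunc hS h
  have hclub : IsClub ({δ : κ.ord.ToType | ∀ γ < δ, δ ∈ Ioi (max (b γ) (c γ))} ∩ Ioi d) :=
    (IsClub.diagonal_inter hW (card_Iic_lt_cof hreg) fun γ => IsClub.Ioi _).inter hW.ne'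
      (IsClub.Ioi d)
  obtain ⟨δ, ⟨hδS, hδR⟩, hδ, hdδ⟩ := hst hclub
  refine ⟨δ, hδS, fun f => ?_, hd δ hdδ⟩
  have hclo := L.isClopen_Iio hR hδR
  -- Lower part: `b γ < δ` makes the evaluation at `δ` after `T` kill every basic function with `γ <
  -- δ`.
  have h1 : T (clopenIndicator hclo f) (L.pt S δ) = 0 := by
    refine L.functional_eq_zero_of_basicFun hR ((evalCLM (L.pt S δ)).comp T) δ (fun γ hγ => ?_) _
      fun x hx => ?_
    · exact hb γ δ ((le_max_left _ _).trans_lt (hδ γ hγ))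
    · exact clopenIndicator_of_notMem hclo f (not_lt.2 hx)
  -- Upper part: `c γ < δ` makes its image vanish at each `γ < δ`, hence at `δ ∈ S`.
  have h2 : T (clopenIndicator hclo.compl f) (L.pt S δ) = 0 := by
    refine L.apply_eq_zero_of_forall_lt hS hδS _ fun γ hγ => ?_
    refine hc γ _ fun x hx => ?_
    exact clopenIndicator_of_notMem hclo.compl f fun hx' =>
      hx' (hx.trans_lt ((le_max_right _ _).trans_lt (hδ γ hγ)))
  rw [← clopenIndicator_add_compl hclo f, map_add, ZeroAtInftyContinuousMap.add_apply, h1, h2, add_zero]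

theorem not_denseRange_zeroAtInfty (hreg : κ.IsRegular) (hunc : ℵ₀ < κ) (hR : R ⊆ cofOmega κ)
    (hS : S ⊆ cofOmega κ) (hst : IsStationary (S \ R))
    (T : C₀(L.Space R, ℝ) →L[ℝ] C₀(L.Space S, ℝ)) : ¬ DenseRange T := by
  intro hT
  obtain ⟨δ, -, hδ, -⟩ := L.exists_common_zero hreg hunc hR hS hst T 0
  have h := hT.equalizer (evalCLM (L.pt S δ)).continuous continuous_zero (funext hδ)
  have h1 := congrFun h (L.basicFun hS δ)
  rw [evalCLM_apply, basicFun_self] at h1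
  exact one_ne_zero h1

theorem not_denseRange_KL (hreg : κ.IsRegular) (hunc : ℵ₀ < κ) (hR : R ⊆ cofOmega κ)
    (hS : S ⊆ cofOmega κ) (hst : IsStationary (S \ R))
    (T : C(L.KL R, ℝ) →L[ℝ] C(L.KL S, ℝ)) : ¬ DenseRange T := by
  intro hT
  have := L.t2Space hR
  have := L.t2Space hS
  -- The operator is compressed to C₀; the extra function accounts for the image of the constants.
  obtain ⟨δ, -, hδ, h1δ⟩ := L.exists_common_zero hreg hunc hR hS hst
    (ofOnePoint.comp (T.comp toOnePoint)) (ofOnePoint (T 1))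
  have hzero : ∀ f, ofOnePoint (T f) (L.pt S δ) = 0 := fun f => by
    rw [← toOnePoint_ofOnePoint f, map_add, map_smul, map_add, map_smul, ZeroAtInftyContinuousMap.add_apply, ZeroAtInftyContinuousMap.smul_apply,
      h1δ, smul_zero, add_zero]
    exact hδ (ofOnePoint f)
  have h := hT.equalizer ((evalCLM (L.pt S δ)).comp ofOnePoint).continuous continuous_zero
    (funext hzero)
  have h1 : (L.basicFun hS δ) (L.pt S δ) - 0 = 0 := congrFun h (toOnePoint (L.basicFun hS δ))
  rw [basicFun_self, sub_zero] at h1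
  exact one_ne_zero h1

end LadderSystem

/-! ### Disjoint stationary families and nonisomorphism -/

namespace IsDisjointStationaryFamily

variable {κ : Cardinal.{u}} {St : κ.ord.ToType → Set κ.ord.ToType}

theorem exists_family (hreg : κ.IsRegular) (hunc : ℵ₀ < κ) :
    ∃ St : κ.ord.ToType → Set κ.ord.ToType, IsDisjointStationaryFamily St := by
  have := noMaxOrder_toType_ord hreg
  have := nonempty_toType_ord hreg
  have hW : ℵ₀ < Order.cof κ.ord.ToType := by rwa [cof_toType_ord hreg]
  obtain ⟨St, h1, h2, h3⟩ := (isStationary_isOmegaLimit hW).exists_disjoint_family hW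
    (by rw [cof_toType_ord hreg, mk_ord_toType]) (card_Iic_lt_cof hreg) fun α hα => hα
  exact ⟨St, fun ξ α hα => mem_cofOmega_iff.2 (h1 ξ hα), h2, h3⟩

theorem iUnion_subset_cofOmega (h : IsDisjointStationaryFamily St) (A : Set κ.ord.ToType) :
    ⋃ ξ ∈ A, St ξ ⊆ cofOmega κ :=
  iUnion₂_subset fun ξ _ => h.subset_cofOmega ξ

theorem isStationary_sdiff (h : IsDisjointStationaryFamily St) {A B : Set κ.ord.ToType}
    {ξ : κ.ord.ToType} (hA : ξ ∈ A) (hB : ξ ∉ B) :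
    IsStationary ((⋃ η ∈ A, St η) \ ⋃ η ∈ B, St η) := by
  refine (h.isStationary ξ).mono fun α hα => ⟨mem_biUnion hA hα, fun hα' => ?_⟩
  obtain ⟨η, hη, hαη⟩ := mem_iUnion₂.1 hα'
  exact disjoint_left.1 (h.disjoint ξ η fun e => hB (e ▸ hη)) hα hαη

theorem isEmpty_equiv (h : IsDisjointStationaryFamily St) (hreg : κ.IsRegular) (hunc : ℵ₀ < κ)
    (L : LadderSystem κ) {A B : Set κ.ord.ToType} (hAB : A ≠ B) :
    IsEmpty (C(L.KL (⋃ ξ ∈ A, St ξ), ℝ) ≃L[ℝ] C(L.KL (⋃ ξ ∈ B, St ξ), ℝ)) := by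
  have hcof := h.iUnion_subset_cofOmega
  refine ⟨fun e => ?_⟩
  by_cases hsub : A ⊆ B
  · obtain ⟨ξ, hB, hA⟩ := not_subset.1 fun hBA => hAB (hsub.antisymm hBA)
    exact L.not_denseRange_KL hreg hunc (hcof A) (hcof B) (h.isStationary_sdiff hB hA)
      e.toContinuousLinearMap e.surjective.denseRange
  · obtain ⟨ξ, hA, hB⟩ := not_subset.1 hsub
    exact L.not_denseRange_KL hreg hunc (hcof B) (hcof A) (h.isStationary_sdiff hA hB)
      e.symm.toContinuousLinearMap e.symm.surjective.denseRange

end IsDisjointStationaryFamily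

theorem theorem1p1 (κ : Cardinal.{u}) (hreg : κ.IsRegular) (hunc : ℵ₀ < κ) :
    -- a family of `2 ^ κ` compact Hausdorff spaces `K` of weight `κ` with pairwise
    -- nonisomorphic Banach spaces `C(K)`
    (∃ (ι : Type u) (K : ι → Type u) (_ : ∀ i, TopologicalSpace (K i))
        (_ : ∀ i, CompactSpace (K i)) (_ : ∀ i, T2Space (K i)),
      #ι = 2 ^ κ ∧
      (∀ i, topologicalWeight (K i) = κ) ∧
      ∀ i j, i ≠ j → IsEmpty (C(K i, ℝ) ≃L[ℝ] C(K j, ℝ))) ∧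
    -- ladder systems and families of `κ` disjoint stationary subsets of `E^κ_ω` exist
    Nonempty (LadderSystem κ) ∧
    (∃ St : κ.ord.ToType → Set κ.ord.ToType, IsDisjointStationaryFamily St) ∧
    -- and any such data produce a family as above, indexed by the subsets `A` of `κ`
    (∀ (L : LadderSystem κ) (St : κ.ord.ToType → Set κ.ord.ToType),
      IsDisjointStationaryFamily St →
      (∀ A : Set κ.ord.ToType,
        CompactSpace (L.KL (⋃ ξ ∈ A, St ξ)) ∧ T2Space (L.KL (⋃ ξ ∈ A, St ξ)) ∧
          topologicalWeight (L.KL (⋃ ξ ∈ A, St ξ)) = κ) ∧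
      ∀ A B : Set κ.ord.ToType, A ≠ B →
        IsEmpty (C(L.KL (⋃ ξ ∈ A, St ξ), ℝ) ≃L[ℝ] C(L.KL (⋃ ξ ∈ B, St ξ), ℝ))) ∧
    -- no operator with dense range when `S \ R` is stationary
    (∀ (L : LadderSystem κ) (R S : Set κ.ord.ToType), R ⊆ cofOmega κ → S ⊆ cofOmega κ →
      IsStationary (S \ R) →
      (¬ ∃ T : C₀(L.Space R, ℝ) →L[ℝ] C₀(L.Space S, ℝ), DenseRange T) ∧
      ¬ ∃ T : C(L.KL R, ℝ) →L[ℝ] C(L.KL S, ℝ), DenseRange T) := by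
  have hpair : ∀ (L : LadderSystem κ) (St : κ.ord.ToType → Set κ.ord.ToType),
      IsDisjointStationaryFamily St →
      (∀ A : Set κ.ord.ToType,
        CompactSpace (L.KL (⋃ ξ ∈ A, St ξ)) ∧ T2Space (L.KL (⋃ ξ ∈ A, St ξ)) ∧
          topologicalWeight (L.KL (⋃ ξ ∈ A, St ξ)) = κ) ∧
      ∀ A B : Set κ.ord.ToType, A ≠ B →
        IsEmpty (C(L.KL (⋃ ξ ∈ A, St ξ), ℝ) ≃L[ℝ] C(L.KL (⋃ ξ ∈ B, St ξ), ℝ)) :=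
    fun L St h => ⟨fun A => ⟨inferInstance, L.t2Space_KL (h.iUnion_subset_cofOmega A),
      L.topologicalWeight_KL hreg (h.iUnion_subset_cofOmega A)⟩,
      fun A B hAB => h.isEmpty_equiv hreg hunc L hAB⟩
  obtain ⟨L⟩ := LadderSystem.exists_ladderSystem (κ := κ)
  obtain ⟨St, hSt⟩ := IsDisjointStationaryFamily.exists_family hreg hunc
  refine ⟨⟨Set κ.ord.ToType, fun A => L.KL (⋃ ξ ∈ A, St ξ), fun A => inferInstance,
    fun A => inferInstance, fun A => ((hpair L St hSt).1 A).2.1, ?_,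
    fun A => ((hpair L St hSt).1 A).2.2, (hpair L St hSt).2⟩, ⟨L⟩, ⟨St, hSt⟩, hpair, ?_⟩
  · rw [mk_set, mk_ord_toType]
  · intro L R S hR hS hst
    exact ⟨fun ⟨T, hT⟩ => L.not_denseRange_zeroAtInfty hreg hunc hR hS hst T hT,
      fun ⟨T, hT⟩ => L.not_denseRange_KL hreg hunc hR hS hst T hT⟩
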